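/- Let $\mathcal{E}$ be the infinitely prolonged equation $$u_{yy} = u_y u_{xx} - (u_x+u)u_{xy} + u_x u_y$$ (a reduction of the universal hierarchy equation), considered on the domain $u_y\neq 0$, with total derivatives $D_x, D_y$. Smooth functions are those depending smoothly on finitely many of the coordinates. A covering of $\mathcal{E}$ with nonlocal variables $w^\beta$ is given by commuting fields $\tilde D_i = D_i+\sum_\beta X_i^\beta\,\partial/\partial w^\beta$, $i\in\{x,y\}$, with smooth $X_i^\beta$. Two coverings $\tau_l\colon\tilde{\mathcal{E}}^l\to\mathcal{E}$, $l=1,2$, are equivalent if there is a diffeomorphism $F\colon\tilde{\mathcal{E}}^1\to\tilde{\mathcal{E}}^2$ with $\tau_2\circ F=\tau_1$ and $F_*(\tilde D_i^1)=\sum_j\mu_i^j\tilde D_j^2$ for some smooth functions $\mu_i^j$ on $\tilde{\mathcal{E}}^2$. For $p\in\mathbb{Z}$ let $\tau^p$ be obtained from the system $$q_{i,y} = (2-i)\,q_{i-1} - \frac{u_x+u}{u_y}\,q_{i-1,y} + \frac{1}{u_y}\,q_{i-2,y},\qquad q_{i,x}=\frac{q_{i-1,y}}{u_y}\qquad (i\in\mathbb{Z})\qquad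 (*)$$ by setting $q_i=0$ for $i<p$ and normalizing the integration constants of the lowest variables as follows. For $p\ne 1$: $q_p=1$ and $q_{p+1}=-(p-1)y$, and the nonlocal variables are $q_i$, $i\ge p+2$. For $p=1$ the variable $q_1$ is a constant that enters no other equation of the cut system, and $q_2$ is a constant too; one sets $q_1=q_2=1$, $q_3=-y$, and the nonlocal variables are $q_i$, $i\ge 4$. Write $q_i^p=q_{p+i+1}$; thus, for $p\neq 1$, $q_{-1}^p=1$, $q_0^p=-(p-1)y$, and $q_i^p$, $i\ge1$, are the nonlocal variables. On polynomials in $q_0^p,q_1^p,\dots$, treated as independent variables, put $\mathcal{Y}^p=\sum_{i\ge0}(i+1)q_{i+1}^p\,\partial/\partial q_i^p$ and $$P_{i,0}^p=\frac{(q_0^p)^{i+2}}{(i+2)!},\qquad P_{i,j}^p=\frac1j\,\mathcal{Y}^p(P_{i,j-1}^p)\qquad (i\ge0,\ j\ge1),$$ with $P_{i,j}^p=0$ if a subscript is negative. Then: 1. Every $\tau^p$ is a covering of $\mathcal{E}$ on which $(*)$ holds for all $i\in\mathbb{Z}$. 2. The coverings $\tau^p$, $p\in\mathbb{Z}$, are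 pairwise equivalent. 3. For $p\neq1$ an equivalence of $\tau^0$ with $\tau^p$ is given by $$q_i^p=-(p-1)\bigl(q_i^0-p\,d_i\bigr),\quad i\ge1,\qquad d_i=\sum_{l=0}^{\infty}(-1)^l\,(p+1)(p+2)\cdots(p+l)\,P^0_{l,\,i-l-1}.$$ 4. For $p=1$: in the system $(*)$ cut by $q_i=0$ for $i<1$, the variable $q_1$ is a constant that enters no other equation, and without it the cut system is the system $(*)$ cut by $q_i=0$ for $i<2$. Accordingly, $\tau^1$ coincides with $\tau^2$. -/

import Mathlib

open scoped ContDiff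

noncomputable section

namespace UHE

/-! ### Smooth functions and vector fields in countably many coordinates

A coordinate domain is a set `U` of points `a : ι → ℝ`; functions and vector fields are total
functions of which only the values on `U` matter. -/

/-- Smooth functions on an infinite-dimensional coordinate domain `U`: those that depend on
finitely many coordinates only, smoothly. -/
def SmoothFn {ι : Type*} (U : Set (ι → ℝ)) (f : (ι → ℝ) → ℝ) : Prop :=
  ∃ (S : Finset ι) (g : (S → ℝ) → ℝ),
    ContDiffOn ℝ ∞ g ((fun (a : ι → ℝ) (s : S) => a s) '' U) ∧
      ∀ a ∈ U, f a = g (fun s => a s)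

open Classical in
/-- The partial derivative `∂f/∂aᵢ` at the point `a`. -/
def pderivAt {ι : Type*} (f : (ι → ℝ) → ℝ) (i : ι) (a : ι → ℝ) : ℝ :=
  deriv (fun t => f (Function.update a i t)) (a i)

/-- A vector field `∑ Xⁱ ∂/∂aᵢ`, given by its components. -/
abbrev VField (ι : Type*) := ι → (ι → ℝ) → ℝ

/-- The action `X(f) = ∑ Xⁱ ∂f/∂aᵢ`; the sum is finite when `f` depends on finitely many
coordinates. -/
def VField.app {ι : Type*} (X : VField ι) (f : (ι → ℝ) → ℝ) (a : ι → ℝ) : ℝ :=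
  ∑ᶠ i, X i a * pderivAt f i a

/-! ### Infinitely prolonged equations, coverings and their equivalence -/

/-- An infinitely prolonged equation in `n` independent variables, in internal coordinates
indexed by `ι`: a coordinate domain with the total derivatives `D₁, …, Dₙ`. -/
structure Diffiety (n : ℕ) (ι : Type*) where
  dom : Set (ι → ℝ)
  D : Fin n → VField ι

/-- The domain is open, the total derivatives are smooth, and they commute. -/
def Diffiety.IsIntegrable {n : ℕ} {ι : Type*} (E : Diffiety n ι) : Prop :=
  IsOpen E.dom ∧
  (∀ i k, SmoothFn E.dom (E.D i k)) ∧
  (∀ i j k, ∀ a ∈ E.dom, (E.D i).app (E.D j k) a = (E.D j).app (E.D i k) a)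

/-- The data of a covering of `E` with nonlocal variables `w^b`, `b : β`: the right-hand sides
`X_i^b` of the system `∂w^b/∂xⁱ = X_i^b`. -/
structure Covering {n : ℕ} {ι : Type*} (E : Diffiety n ι) (β : Type*) where
  X : Fin n → β → (ι ⊕ β → ℝ) → ℝ

/-- The projection of the total space of a covering to the base. -/
def proj {ι β : Type*} (a : ι ⊕ β → ℝ) : ι → ℝ := fun k => a (Sum.inl k)

/-- The total space of a covering, with the total derivatives
`D̃ᵢ = Dᵢ + ∑ X_i^b ∂/∂w^b` (which project to the `Dᵢ`). -/
def Covering.total {n : ℕ} {ι β : Type*} {E : Diffiety n ι} (c : Covering E β) :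
    Diffiety n (ι ⊕ β) where
  dom := {a | proj a ∈ E.dom}
  D i := Sum.elim (fun k a => E.D i k (proj a)) (c.X i)

/-- The data `c` are a covering of `E`: the system `∂w^b/∂xⁱ = X_i^b` is smooth and
compatible on `E`. -/
def Covering.IsCovering {n : ℕ} {ι β : Type*} {E : Diffiety n ι} (c : Covering E β) : Prop :=
  E.IsIntegrable ∧ c.total.IsIntegrable

/-- `F` is an equivalence of the coverings `c₁` and `c₂` of `E`: a diffeomorphism (with inverse
`G`) of the total spaces over `E` such that `F_* D̃ᵢ¹ = ∑ⱼ μᵢʲ D̃ⱼ²` for some smooth functions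
`μᵢʲ` on the second total space. The `k`-th component of `F_* Z` at `b` is `Z(Fᵏ)` at `G b`. -/
def Covering.IsEquivalence {n : ℕ} {ι β₁ β₂ : Type*} {E : Diffiety n ι}
    (c₁ : Covering E β₁) (c₂ : Covering E β₂) (F : (ι ⊕ β₁ → ℝ) → (ι ⊕ β₂ → ℝ)) : Prop :=
  ∃ G : (ι ⊕ β₂ → ℝ) → (ι ⊕ β₁ → ℝ),
    (∀ a ∈ c₁.total.dom, F a ∈ c₂.total.dom ∧ G (F a) = a) ∧
    (∀ b ∈ c₂.total.dom, G b ∈ c₁.total.dom ∧ F (G b) = b) ∧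
    (∀ k, SmoothFn c₁.total.dom (fun a => F a k)) ∧
    (∀ k, SmoothFn c₂.total.dom (fun b => G b k)) ∧
    (∀ a ∈ c₁.total.dom, proj (F a) = proj a) ∧
    ∃ μ : Fin n → Fin n → (ι ⊕ β₂ → ℝ) → ℝ,
      (∀ i j, SmoothFn c₂.total.dom (μ i j)) ∧
      ∀ i, ∀ b ∈ c₂.total.dom, ∀ k,
        (c₁.total.D i).app (fun a => F a k) (G b) = ∑ j, μ i j b * c₂.total.D j k b

/-- Two coverings of `E` are equivalent. -/
def Covering.Equivalent {n : ℕ} {ι β₁ β₂ : Type*} {E : Diffiety n ι}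
    (c₁ : Covering E β₁) (c₂ : Covering E β₂) : Prop :=
  ∃ F : (ι ⊕ β₁ → ℝ) → (ι ⊕ β₂ → ℝ), c₁.IsEquivalence c₂ F

/-! ### The reduction `u_yy = u_y u_xx - (u_x + u) u_xy + u_x u_y` -/

/-- Internal coordinates: `x`, `y`, `u k` is `∂ₓᵏ u` and `uy k` is `∂ₓᵏ u_y`; all other
derivatives of `u` are expressed through these by the equation and its prolongations. -/
inductive JetCoord : Type
  | x : JetCoord
  | y : JetCoord
  | u (k : ℕ) : JetCoord
  | uy (k : ℕ) : JetCoord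

/-- The right-hand side of the equation. -/
def rhs (a : JetCoord → ℝ) : ℝ :=
  a (.uy 0) * a (.u 2) - (a (.u 1) + a (.u 0)) * a (.uy 1) + a (.u 1) * a (.uy 0)

/-- The total derivative `D_x` on the equation. -/
def Dx : VField JetCoord
  | .x, _ => 1
  | .y, _ => 0
  | .u k, a => a (.u (k + 1))
  | .uy k, a => a (.uy (k + 1))

/-- The total derivative `D_y` on the equation; `D_y (∂ₓᵏ u_y) = D_xᵏ (u_yy)`. -/
def Dy : VField JetCoord
  | .x, _ => 0
  | .y, _ => 1
  | .u k, a => a (.uy k)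
  | .uy k, a => (Dx.app)^[k] rhs a

/-- The infinitely prolonged equation, on the domain `u_y ≠ 0` where the coverings are defined;
the independent variables are `0 ↦ x` and `1 ↦ y`. -/
def equation : Diffiety 2 JetCoord where
  dom := {a | a (.uy 0) ≠ 0}
  D := ![Dx, Dy]

/-! ### The coverings `τ^p` -/

/-- The right-hand sides of the system
`q_{i,y} = (2 - i) q_{i-1} - ((u_x + u) / u_y) q_{i-1,y} + (1 / u_y) q_{i-2,y}`
cut at level `p`, i.e. with `q_i = 0` for `i < p`. -/
def cutY (p : ℤ) (a : JetCoord → ℝ) (q : ℤ → ℝ) (i : ℤ) : ℝ :=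
  if i < p then 0
  else (2 - (i : ℝ)) * q (i - 1)
    - (a (.u 1) + a (.u 0)) / a (.uy 0) * cutY p a q (i - 1)
    + 1 / a (.uy 0) * cutY p a q (i - 2)
termination_by (i - p + 1).toNat
decreasing_by all_goals omega

/-- The right-hand sides of the system `q_{i,x} = q_{i-1,y} / u_y` cut at level `p`. -/
def cutX (p : ℤ) (a : JetCoord → ℝ) (q : ℤ → ℝ) (i : ℤ) : ℝ :=
  cutY p a q (i - 1) / a (.uy 0)

/-- The index of the first nonlocal variable of `τ^p`. -/
def firstNonlocal (p : ℤ) : ℤ := if p = 1 then 4 else p + 2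

/-- The variables `q_i`, `i ∈ ℤ`, on the total space of `τ^p`. They vanish for `i < p`. For
`p ≠ 1` one has `q_p = 1` and `q_{p+1} = (1 - p) y`. For `p = 1` the variable `q_1 = 1` enters no
equation of the cut system, the lowest variable that does is the constant `q_2`, normalized
to `q_2 = 1`, and `q_3 = -y`. All the remaining `q_i` are the fibre coordinates. -/
def tauVar (p : ℤ) (a : JetCoord ⊕ ℕ → ℝ) (i : ℤ) : ℝ :=
  if i < p then 0
  else if i < firstNonlocal p then
    if p = 1 then (if i ≤ 2 then 1 else -a (.inl .y))
    else (if i = p then 1 else (1 - (p : ℝ)) * a (.inl .y))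
  else a (.inr (i - firstNonlocal p).toNat)

/-- The covering `τ^p`. -/
def tau (p : ℤ) : Covering equation ℕ where
  X := ![fun n a => cutX p (proj a) (tauVar p a) (firstNonlocal p + n),
         fun n a => cutY p (proj a) (tauVar p a) (firstNonlocal p + n)]

/-- The variables `q_i^p = q_{p+i+1}` of `τ^p`, `i ≥ -1`. -/
def qSup (p : ℤ) (a : JetCoord ⊕ ℕ → ℝ) (i : ℤ) : ℝ := tauVar p a (p + i + 1)

/-! ### The change of variables -/

/-- The operator `𝒴 = ∑_{i ≥ 0} (i + 1) q_{i+1} ∂/∂q_i` on polynomials in `q_0, q_1, …`. -/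
def opY : Derivation ℝ (MvPolynomial ℕ ℝ) (MvPolynomial ℕ ℝ) :=
  MvPolynomial.mkDerivation ℝ
    (fun i : ℕ => MvPolynomial.C ((i : ℝ) + 1) * MvPolynomial.X (i + 1))

/-- `P_{i,0} = q_0^{i+2} / (i+2)!` and `P_{i,j} = (1/j) 𝒴(P_{i,j-1})`, as polynomials in
`q_0, q_1, …`. -/
def P (i : ℕ) : ℕ → MvPolynomial ℕ ℝ
  | 0 => MvPolynomial.C (1 / ((i + 2).factorial : ℝ)) * MvPolynomial.X 0 ^ (i + 2)
  | j + 1 => MvPolynomial.C (1 / ((j : ℝ) + 1)) * opY (P i j)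

/-- The quantities `P_{i,j}^p` on the total space of `τ^p`. -/
def PSup (p : ℤ) (i j : ℕ) (a : JetCoord ⊕ ℕ → ℝ) : ℝ :=
  MvPolynomial.eval (fun k : ℕ => qSup p a k) (P i j)

/-- `d_i = ∑_{l ≥ 0} (-1)^l ((p+l)!/p!) P_{l,i-l-1}^0`, where `(p+l)!/p! = (p+1)⋯(p+l)`. The terms
with `l ≥ i` vanish, the second subscript being negative. -/
def dCoeff (p : ℤ) (i : ℕ) (a : JetCoord ⊕ ℕ → ℝ) : ℝ :=
  ∑ l ∈ Finset.range i,
    (-1) ^ l * (∏ k ∈ Finset.Icc 1 l, ((p : ℝ) + k)) * PSup 0 l (i - l - 1) a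

/-- The map from the total space of `τ^0` to that of `τ^p`, `p ≠ 1`, over the equation, given by
`q_i^p = -(p - 1)(q_i^0 - p d_i)`, `i ≥ 1`; the fibre coordinate `n` is `q_{n+1}^p`. -/
def changeVars (p : ℤ) (a : JetCoord ⊕ ℕ → ℝ) : JetCoord ⊕ ℕ → ℝ
  | .inl k => a (.inl k)
  | .inr n => -((p : ℝ) - 1) * (qSup 0 a (n + 1) - p * dCoeff p (n + 1) a)

end UHE

end

noncomputable section

namespace UHE

/-! ### Calculus of smooth functions of finitely many coordinates -/

section Calculus

variable {ι : Type*} {U : Set (ι → ℝ)} {f g : (ι → ℝ) → ℝ}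

/-! Let W = ∑ q_{p+n} λⁿ be the generating function of the variables of `τ^p`. Since 2 - (p+n) =
(1-p) - (n-1), the cut system sums up to A·W_y = λ((1-p)W - λ W_λ) and W_x = λ W_y / u_y, where A =
1 + ((u_x+u)/u_y) λ - (1/u_y) λ² does not depend on p (`symbolSeries_mul_cutSeries`). Apart from
multiplication by 1-p, only derivations act on W. If p ≠ 1, the constant term of W is 1, so W^β
makes sense, and it satisfies the same equations with 1-p replaced by β(1-p).

For p, r ≠ 1 the exponent β = (1-r)/(1-p) therefore carries `τ^p` to `τ^r`, the normalizations
included (`tauSeries_powMap`, `app_powMap_inr`), and the reciprocal exponent inverts the map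
(`rpow_rpow_inv`). For p = 1 the exponent degenerates, but the factor 2-i vanishes at i = 2, so q_1
drops out and `τ^1` is `τ^2`.

The explicit formula is the binomial expansion of W^(1-p) for p = 0. Write W = 1 + λq. The operator
𝒴 acts on q as d/dλ, so P_{l,j} is the coefficient of λ^j in q^(l+2)/(l+2)! (`P_eq_coeff`).

Compatibility of the system is proved by induction on i (`app_cutY_eq_app_cutX`). With s =
(u_x+u)/u_y and v = 1/u_y it reduces to D_x s + D_y v = 0, which is the equation itself, and D_x v -
s D_y v + v D_y s = v. -/

theorem isOpen_image_restrict (hU : IsOpen U) (S : Finset ι) :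
    IsOpen ((fun (a : ι → ℝ) (s : S) => a s) '' U) := by
  classical
  rw [isOpen_iff_mem_nhds]
  rintro _ ⟨a, ha, rfl⟩
  -- A continuous section of the restriction map through `a`: the coordinates outside `S` are frozen
  -- at their values in `a`.
  let σ : (S → ℝ) → ι → ℝ := fun z i => if h : i ∈ S then z ⟨i, h⟩ else a i
  have hσ : Continuous σ := by
    refine continuous_pi fun i => ?_
    by_cases h : i ∈ S
    · simpa [σ, h] using continuous_apply _
    · simpa [σ, h] using continuous_const
  have h1 : σ (fun s => a s) = a := by
    funext i
    simp [σ]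
  have h2 : σ ⁻¹' U ∈ nhds (fun s : S => a s) :=
    (hU.preimage hσ).mem_nhds (by rw [Set.mem_preimage, h1]; exact ha)
  refine Filter.mem_of_superset h2 fun z hz => ⟨σ z, hz, ?_⟩
  funext s
  simp [σ]

theorem hasDerivAt_comp_curve_of_eqOn (hU : IsOpen U) {S : Finset ι} {φ : (S → ℝ) → ℝ}
    (hφ : ContDiffOn ℝ ∞ φ ((fun (a : ι → ℝ) (s : S) => a s) '' U))
    (hf : ∀ a ∈ U, f a = φ (fun s => a s)) {γ : ℝ → ι → ℝ} {t₀ : ℝ} (h₀ : γ t₀ ∈ U)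
    {c : ι → ℝ} (hγ : ∀ i, HasDerivAt (fun t => γ t i) (c i) t₀) :
    HasDerivAt (fun t => f (γ t)) (fderiv ℝ φ (fun s => γ t₀ s) (fun s => c s)) t₀ := by
  have hcont : ContinuousAt γ t₀ := continuousAt_pi.2 fun i => (hγ i).continuousAt
  have hev : ∀ᶠ t in nhds t₀, γ t ∈ U := hcont.eventually (hU.mem_nhds h₀)
  have hd : HasFDerivAt φ (fderiv ℝ φ (fun s => γ t₀ s)) (fun s => γ t₀ s) :=
    ((hφ.contDiffAt ((isOpen_image_restrict hU S).mem_nhds ⟨_, h₀, rfl⟩)).differentiableAt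
      (by simp)).hasFDerivAt
  have hr : HasDerivAt (fun t => fun s : S => γ t s) (fun s : S => c s) t₀ :=
    hasDerivAt_pi.2 fun s => hγ s
  exact (hd.comp_hasDerivAt t₀ hr).congr_of_eventuallyEq (hev.mono fun t ht => hf _ ht)

theorem pderivAt_eq_fderiv (hU : IsOpen U) {S : Finset ι} {φ : (S → ℝ) → ℝ}
    (hφ : ContDiffOn ℝ ∞ φ ((fun (a : ι → ℝ) (s : S) => a s) '' U))
    (hf : ∀ a ∈ U, f a = φ (fun s => a s)) {a : ι → ℝ} (ha : a ∈ U) (i : ι) :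
    pderivAt f i a =
      fderiv ℝ φ (fun s => a s) (fun s => open Classical in (Pi.single i 1 : ι → ℝ) s) := by
  classical
  have := hasDerivAt_comp_curve_of_eqOn (f := f) hU hφ hf (t₀ := a i)
    (γ := fun t => Function.update a i t) (c := Pi.single i 1) (by simpa using ha) (by
      intro j
      rcases eq_or_ne j i with rfl | h
      · simpa using hasDerivAt_id' _
      · simpa [h] using hasDerivAt_const (a i) (a j))
  simp only [Function.update_eq_self] at this
  rw [pderivAt]
  convert this.deriv using 1

theorem app_eq_sum_fderiv (hU : IsOpen U) {S : Finset ι} {φ : (S → ℝ) → ℝ}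
    (hφ : ContDiffOn ℝ ∞ φ ((fun (a : ι → ℝ) (s : S) => a s) '' U))
    (hf : ∀ a ∈ U, f a = φ (fun s => a s)) (X : VField ι) {a : ι → ℝ} (ha : a ∈ U) :
    X.app f a = ∑ s : S, X s a *
      fderiv ℝ φ (fun s => a s) (open Classical in (Pi.single s 1 : S → ℝ)) := by
  classical
  have hp := pderivAt_eq_fderiv (f := f) hU hφ hf ha
  rw [VField.app, finsum_eq_sum_of_support_subset (s := S), ← Finset.sum_coe_sort]
  · refine Finset.sum_congr rfl fun s _ => ?_
    rw [hp]
    congr 2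
    funext s'
    simp only [Pi.single_apply, Subtype.ext_iff]
  · intro i hi
    by_contra h
    refine hi ?_
    have : (fun s : S => (Pi.single i 1 : ι → ℝ) s) = 0 := by
      funext s
      have : (s : ι) ≠ i := fun h' => h (h' ▸ s.2)
      simp [this]
    simp only [hp]
    convert mul_zero _
    convert map_zero (fderiv ℝ φ fun s => a s)

/-- A smooth function is differentiated along a curve by the velocity of the curve. -/
theorem SmoothFn.hasDerivAt_comp (hf : SmoothFn U f) (hU : IsOpen U) (X : VField ι)
    {γ : ℝ → ι → ℝ} {t₀ : ℝ} (h₀ : γ t₀ ∈ U)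
    (hγ : ∀ i, HasDerivAt (fun t => γ t i) (X i (γ t₀)) t₀) :
    HasDerivAt (fun t => f (γ t)) (X.app f (γ t₀)) t₀ := by
  classical
  obtain ⟨S, φ, hφ, hfφ⟩ := hf
  convert hasDerivAt_comp_curve_of_eqOn (f := f) hU hφ hfφ h₀ hγ using 1
  rw [app_eq_sum_fderiv hU hφ hfφ X h₀]
  refine Eq.trans ?_ (LinearMap.pi_apply_eq_sum_univ (fderiv ℝ φ fun s => γ t₀ s).toLinearMap
    fun s => X s (γ t₀)).symm
  refine Finset.sum_congr rfl fun s _ => ?_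
  simp only [smul_eq_mul, ContinuousLinearMap.coe_coe]
  congr 2
  funext j
  simp [Pi.single_apply, eq_comm]

/-- The straight line through `a` with velocity `X a`. -/
def VField.line (X : VField ι) (a : ι → ℝ) (t : ℝ) : ι → ℝ := fun i => a i + t * X i a

@[simp] theorem VField.line_zero (X : VField ι) (a : ι → ℝ) : X.line a 0 = a := by
  funext i; simp [VField.line]

theorem VField.hasDerivAt_line (X : VField ι) (a : ι → ℝ) (i : ι) :
    HasDerivAt (fun t => X.line a t i) (X i (X.line a 0)) 0 := by
  simpa [VField.line] using ((hasDerivAt_id (0 : ℝ)).mul_const (X i a)).const_add (a i)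

/-- Turns `X.app f` into an ordinary one-variable derivative. The rules for sums, products and
quotients below then follow from uniqueness of derivatives, without handling the `finsum`. -/
theorem SmoothFn.hasDerivAt_line (hf : SmoothFn U f) (hU : IsOpen U) (X : VField ι)
    {a : ι → ℝ} (ha : a ∈ U) : HasDerivAt (fun t => f (X.line a t)) (X.app f a) 0 := by
  simpa using hf.hasDerivAt_comp hU X (γ := X.line a) (t₀ := 0) (by simpa using ha)
    (X.hasDerivAt_line a)

theorem SmoothFn.congr (hf : SmoothFn U f) (h : ∀ a ∈ U, g a = f a) : SmoothFn U g := by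
  obtain ⟨S, φ, hφ, hfφ⟩ := hf
  exact ⟨S, φ, hφ, fun a ha => (h a ha).trans (hfφ a ha)⟩

/-- The two representatives are pulled back to the union of their coordinate sets; all arithmetic
operations become special cases. -/
theorem SmoothFn.comp₂ (hf : SmoothFn U f) (hg : SmoothFn U g) {V : Set (ℝ × ℝ)}
    {h : ℝ × ℝ → ℝ} (hh : ContDiffOn ℝ ∞ h V) (hV : ∀ a ∈ U, (f a, g a) ∈ V) :
    SmoothFn U (fun a => h (f a, g a)) := by
  classical
  obtain ⟨S, φ, hφ, hfφ⟩ := hf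
  obtain ⟨T, ψ, hψ, hgψ⟩ := hg
  let rS : (↥(S ∪ T) → ℝ) → S → ℝ := fun z s => z ⟨s, Finset.mem_union_left T s.2⟩
  let rT : (↥(S ∪ T) → ℝ) → T → ℝ := fun z s => z ⟨s, Finset.mem_union_right S s.2⟩
  refine ⟨S ∪ T, fun z => h (φ (rS z), ψ (rT z)), ?_, fun a ha => ?_⟩
  · have hS : ContDiff ℝ ∞ rS := contDiff_pi.2 fun s => contDiff_apply ℝ ℝ _
    have hT : ContDiff ℝ ∞ rT := contDiff_pi.2 fun s => contDiff_apply ℝ ℝ _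
    refine hh.comp ((hφ.comp hS.contDiffOn ?_).prodMk (hψ.comp hT.contDiffOn ?_)) ?_
    · rintro _ ⟨a, ha, rfl⟩
      exact ⟨a, ha, rfl⟩
    · rintro _ ⟨a, ha, rfl⟩
      exact ⟨a, ha, rfl⟩
    · rintro _ ⟨a, ha, rfl⟩
      have := hV a ha
      rw [hfφ a ha, hgψ a ha] at this
      exact this
  · simp only [hfφ a ha, hgψ a ha]
    rfl

theorem smoothFn_const (c : ℝ) : SmoothFn U (fun _ => c) :=
  ⟨∅, fun _ => c, contDiffOn_const, fun _ _ => rfl⟩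

theorem smoothFn_coord (i : ι) : SmoothFn U (fun a => a i) :=
  ⟨{i}, fun z => z ⟨i, by simp⟩, (contDiff_apply ℝ ℝ _).contDiffOn, fun _ _ => rfl⟩

theorem SmoothFn.add (hf : SmoothFn U f) (hg : SmoothFn U g) :
    SmoothFn U (fun a => f a + g a) :=
  hf.comp₂ hg (V := Set.univ) (h := fun z => z.1 + z.2) (by fun_prop) (by simp)

theorem SmoothFn.sub (hf : SmoothFn U f) (hg : SmoothFn U g) :
    SmoothFn U (fun a => f a - g a) :=
  hf.comp₂ hg (V := Set.univ) (h := fun z => z.1 - z.2) (by fun_prop) (by simp)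

theorem SmoothFn.mul (hf : SmoothFn U f) (hg : SmoothFn U g) :
    SmoothFn U (fun a => f a * g a) :=
  hf.comp₂ hg (V := Set.univ) (h := fun z => z.1 * z.2) (by fun_prop) (by simp)

theorem SmoothFn.div (hf : SmoothFn U f) (hg : SmoothFn U g) (h0 : ∀ a ∈ U, g a ≠ 0) :
    SmoothFn U (fun a => f a / g a) :=
  hf.comp₂ hg (V := {z | z.2 ≠ 0}) (h := fun z => z.1 / z.2)
    (contDiffOn_fst.div contDiffOn_snd fun _ h => h) h0

theorem SmoothFn.sum {κ : Type*} (s : Finset κ) {F : κ → (ι → ℝ) → ℝ}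
    (hF : ∀ k ∈ s, SmoothFn U (F k)) : SmoothFn U (fun a => ∑ k ∈ s, F k a) := by
  classical
  induction s using Finset.induction_on with
  | empty => simpa using smoothFn_const 0
  | insert k s hk ih =>
    simp only [Finset.sum_insert hk]
    exact (hF k (by simp)).add (ih fun j hj => hF j (by simp [hj]))

theorem SmoothFn.app (hf : SmoothFn U f) (hU : IsOpen U) {X : VField ι}
    (hX : ∀ i, SmoothFn U (X i)) : SmoothFn U (X.app f) := by
  classical
  obtain ⟨S, φ, hφ, hfφ⟩ := hf
  refine SmoothFn.congr (f := fun a => ∑ s : S, X s a *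
      fderiv ℝ φ (fun s => a s) (Pi.single s 1 : S → ℝ)) ?_ ?_
  · refine SmoothFn.sum _ fun s _ => (hX s).mul ⟨S, fun z => fderiv ℝ φ z (Pi.single s 1), ?_,
      fun _ _ => rfl⟩
    exact (hφ.fderiv_of_isOpen (isOpen_image_restrict hU S) (by simp)).clm_apply
      contDiffOn_const
  · intro a ha
    rw [app_eq_sum_fderiv hU hφ hfφ X ha]

theorem SmoothFn.comp_proj {β : Type*} (hf : SmoothFn U f) :
    SmoothFn {a : ι ⊕ β → ℝ | proj a ∈ U} (fun a => f (proj a)) := by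
  obtain ⟨S, φ, hφ, hfφ⟩ := hf
  let e : ι ↪ ι ⊕ β := ⟨Sum.inl, Sum.inl_injective⟩
  let r : (↥(S.map e) → ℝ) → S → ℝ := fun z s => z ⟨e s, Finset.mem_map_of_mem e s.2⟩
  refine ⟨S.map e, fun z => φ (r z), ?_, fun a ha => hfφ _ ha⟩
  refine hφ.comp (contDiff_pi.2 fun s => contDiff_apply ℝ ℝ _).contDiffOn ?_
  rintro _ ⟨a, ha, rfl⟩
  exact ⟨proj a, ha, rfl⟩

/-! ### Rules for the action of a vector field on smooth functions -/

variable {X : VField ι} {a : ι → ℝ}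

theorem VField.app_coord (X : VField ι) (i : ι) (a : ι → ℝ) :
    X.app (fun b => b i) a = X i a := by
  have h := (smoothFn_coord (U := Set.univ) i).hasDerivAt_line isOpen_univ X (Set.mem_univ a)
  simpa using h.unique (X.hasDerivAt_line a i)

theorem VField.app_const (X : VField ι) (c : ℝ) (a : ι → ℝ) :
    X.app (fun _ => c) a = 0 := by
  have h := (smoothFn_const (U := Set.univ) c).hasDerivAt_line isOpen_univ X (Set.mem_univ a)
  exact h.unique (hasDerivAt_const _ _)

theorem SmoothFn.app_add (hf : SmoothFn U f) (hg : SmoothFn U g) (hU : IsOpen U) (ha : a ∈ U) :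
    X.app (fun b => f b + g b) a = X.app f a + X.app g a :=
  ((hf.add hg).hasDerivAt_line hU X ha).unique
    ((hf.hasDerivAt_line hU X ha).add (hg.hasDerivAt_line hU X ha))

theorem SmoothFn.app_sub (hf : SmoothFn U f) (hg : SmoothFn U g) (hU : IsOpen U) (ha : a ∈ U) :
    X.app (fun b => f b - g b) a = X.app f a - X.app g a :=
  ((hf.sub hg).hasDerivAt_line hU X ha).unique
    ((hf.hasDerivAt_line hU X ha).sub (hg.hasDerivAt_line hU X ha))

theorem SmoothFn.app_mul (hf : SmoothFn U f) (hg : SmoothFn U g) (hU : IsOpen U) (ha : a ∈ U) :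
    X.app (fun b => f b * g b) a = X.app f a * g a + f a * X.app g a := by
  simpa using ((hf.mul hg).hasDerivAt_line hU X ha).unique
    ((hf.hasDerivAt_line hU X ha).mul (hg.hasDerivAt_line hU X ha))

theorem SmoothFn.app_const_mul (c : ℝ) (hf : SmoothFn U f) (hU : IsOpen U) (ha : a ∈ U) :
    X.app (fun b => c * f b) a = c * X.app f a := by
  rw [(smoothFn_const c).app_mul hf hU ha, VField.app_const, zero_mul, zero_add]

theorem SmoothFn.app_div (hf : SmoothFn U f) (hg : SmoothFn U g) (h0 : ∀ b ∈ U, g b ≠ 0)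
    (hU : IsOpen U) (ha : a ∈ U) :
    X.app (fun b => f b / g b) a = (X.app f a * g a - f a * X.app g a) / g a ^ 2 := by
  simpa using ((hf.div hg h0).hasDerivAt_line hU X ha).unique
    ((hf.hasDerivAt_line hU X ha).div (hg.hasDerivAt_line hU X ha) (by simpa using h0 a ha))

end Calculus

/-! ### The equation -/

theorem isOpen_equation_dom : IsOpen equation.dom :=
  isOpen_ne_fun (continuous_apply (JetCoord.uy 0)) continuous_const

theorem smoothFn_rhs : SmoothFn equation.dom rhs :=
  (((smoothFn_coord _).mul (smoothFn_coord _)).sub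
    (((smoothFn_coord _).add (smoothFn_coord _)).mul (smoothFn_coord _))).add
      ((smoothFn_coord _).mul (smoothFn_coord _))

theorem smoothFn_Dx (k : JetCoord) : SmoothFn equation.dom (Dx k) := by
  cases k with
  | x => exact smoothFn_const 1
  | y => exact smoothFn_const 0
  | u k => exact smoothFn_coord _
  | uy k => exact smoothFn_coord _

theorem smoothFn_iterate_Dx_rhs (k : ℕ) : SmoothFn equation.dom ((Dx.app)^[k] rhs) := by
  induction k with
  | zero => exact smoothFn_rhs
  | succ k ih =>
    rw [Function.iterate_succ_apply']
    exact ih.app isOpen_equation_dom smoothFn_Dx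

theorem smoothFn_Dy (k : JetCoord) : SmoothFn equation.dom (Dy k) := by
  cases k with
  | x => exact smoothFn_const 0
  | y => exact smoothFn_const 1
  | u k => exact smoothFn_coord _
  | uy k => exact smoothFn_iterate_Dx_rhs k

/-- Commutation is built into the coordinates: `Dy` on `uy k` is the `k`-th iterate of `Dx.app` on
`rhs`, so `Dx` just raises `k`. -/
theorem Dx_app_Dy (k : JetCoord) (a : JetCoord → ℝ) : Dx.app (Dy k) a = Dy.app (Dx k) a := by
  cases k with
  | x => exact (Dx.app_const 0 a).trans (Dy.app_const 1 a).symm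
  | y => exact (Dx.app_const 1 a).trans (Dy.app_const 0 a).symm
  | u k => exact (Dx.app_coord (.uy k) a).trans (Dy.app_coord (.u (k + 1)) a).symm
  | uy k =>
    refine Eq.trans ?_ (Dy.app_coord (.uy (k + 1)) a).symm
    exact (congrFun (Function.iterate_succ_apply' Dx.app k rhs) a).symm

theorem isIntegrable_equation : equation.IsIntegrable := by
  refine ⟨isOpen_equation_dom, fun i k => ?_, fun i j k a _ => ?_⟩
  · fin_cases i
    · exact smoothFn_Dx k
    · exact smoothFn_Dy k
  · fin_cases i <;> fin_cases j
    · rfl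
    · exact Dx_app_Dy k a
    · exact (Dx_app_Dy k a).symm
    · rfl

/-! ### Coverings -/

theorem Covering.isOpen_total_dom {n : ℕ} {ι β : Type*} {E : Diffiety n ι} (c : Covering E β)
    (h : IsOpen E.dom) : IsOpen c.total.dom :=
  h.preimage (continuous_pi fun k => continuous_apply (Sum.inl k))

theorem Covering.app_comp_proj {n : ℕ} {ι β : Type*} {E : Diffiety n ι} (c : Covering E β)
    (hE : IsOpen E.dom) {f : (ι → ℝ) → ℝ} (hf : SmoothFn E.dom f) (i : Fin n)
    {a : ι ⊕ β → ℝ} (ha : a ∈ c.total.dom) :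
    (c.total.D i).app (fun b => f (proj b)) a = (E.D i).app f (proj a) := by
  have h1 := (hf.comp_proj (β := β)).hasDerivAt_line (c.isOpen_total_dom hE) (c.total.D i) ha
  have h2 := hf.hasDerivAt_comp hE (E.D i)
    (γ := fun t => proj ((c.total.D i).line a t)) (t₀ := 0)
    (by rw [VField.line_zero]; exact ha)
    (fun k => (c.total.D i).hasDerivAt_line a (Sum.inl k))
  simpa using h1.unique h2

/-- Only the fibre components need checking; the base components are lifted from `E` by
`Covering.app_comp_proj`. -/
theorem Covering.isIntegrable_total {n : ℕ} {ι β : Type*} {E : Diffiety n ι} (c : Covering E β)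
    (hE : E.IsIntegrable) (hX : ∀ i b, SmoothFn c.total.dom (c.X i b))
    (hc : ∀ i j b, ∀ a ∈ c.total.dom,
      (c.total.D i).app (c.X j b) a = (c.total.D j).app (c.X i b) a) :
    c.total.IsIntegrable := by
  refine ⟨c.isOpen_total_dom hE.1, fun i k => ?_, fun i j k a ha => ?_⟩
  · cases k with
    | inl k => exact (hE.2.1 i k).comp_proj
    | inr b => exact hX i b
  · cases k with
    | inl k =>
      have h1 := c.app_comp_proj hE.1 (hE.2.1 j k) i ha
      have h2 := c.app_comp_proj hE.1 (hE.2.1 i k) j ha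
      exact h1.trans ((hE.2.2 i j k _ ha).trans h2.symm)
    | inr b => exact hc i j b a ha

/-! ### The systems cut at level `p` -/

theorem cutY_of_lt {p i : ℤ} (h : i < p) (a : JetCoord → ℝ) (q : ℤ → ℝ) : cutY p a q i = 0 := by
  rw [cutY, if_pos h]

theorem cutX_of_le {p i : ℤ} (h : i ≤ p) (a : JetCoord → ℝ) (q : ℤ → ℝ) : cutX p a q i = 0 := by
  rw [cutX, cutY_of_lt (by omega), zero_div]

/-- If `q` vanishes below `p`, the recursion for the right-hand sides holds for all `i`. -/
theorem cutY_eq {p : ℤ} {q : ℤ → ℝ} (hq : ∀ i < p, q i = 0) (a : JetCoord → ℝ) (i : ℤ) :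
    cutY p a q i = (2 - (i : ℝ)) * q (i - 1)
      - (a (.u 1) + a (.u 0)) / a (.uy 0) * cutY p a q (i - 1)
      + 1 / a (.uy 0) * cutY p a q (i - 2) := by
  by_cases h : i < p
  · rw [cutY_of_lt h, cutY_of_lt (by omega), cutY_of_lt (by omega), hq _ (by omega)]
    ring
  · rw [cutY, if_neg h]

/-- Induction adapted to a two-step recursion that is trivial below `p`. -/
theorem int_induction_two {p : ℤ} {C : ℤ → Prop} (h0 : ∀ i < p, C i)
    (h : ∀ i, p ≤ i → C (i - 1) → C (i - 2) → C i) (i : ℤ) : C i := by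
  have key : ∀ n : ℕ, ∀ i < p + n, C i := by
    intro n
    induction n with
    | zero => simpa using h0
    | succ n ih =>
      intro i hi
      by_cases hp : i < p
      · exact h0 i hp
      · push_cast at hi
        exact h i (by omega) (ih _ (by omega)) (ih _ (by omega))
  exact key (i - p + 1).toNat i (by omega)

/-- The variable q_1 could enter only through the term (2-i) q_{i-1} at i = 2, where its factor is
zero. The right-hand side at i = 1 vanishes because q_0 = 0. -/
theorem cutY_one_eq (a : JetCoord → ℝ) {q q' : ℤ → ℝ} (h0 : q 0 = 0)
    (h : ∀ i, 2 ≤ i → q i = q' i) (i : ℤ) : cutY 1 a q i = cutY 2 a q' i := by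
  induction i using int_induction_two (p := 1) with
  | h0 i hi => rw [cutY_of_lt hi, cutY_of_lt (by omega)]
  | h i hi h1 h2 =>
    rcases (by omega : i = 1 ∨ i = 2 ∨ 3 ≤ i) with rfl | rfl | h3
    · rw [cutY, if_neg (by norm_num), h1, h2, cutY_of_lt (by norm_num), cutY_of_lt (by norm_num),
        cutY_of_lt (by norm_num)]
      simp [h0]
    · rw [cutY, if_neg (by norm_num), h1, h2, cutY.eq_def 2 a q' 2, if_neg (by norm_num)]
      simp
    · rw [cutY, if_neg (by omega), h1, h2, cutY.eq_def 2 a q' i, if_neg (by omega),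
        h _ (by omega)]

theorem cutX_one_eq (a : JetCoord → ℝ) {q q' : ℤ → ℝ} (h0 : q 0 = 0)
    (h : ∀ i, 2 ≤ i → q i = q' i) (i : ℤ) : cutX 1 a q i = cutX 2 a q' i := by
  rw [cutX, cutX, cutY_one_eq a h0 h]

/-! ### The coverings -/

theorem tauVar_of_lt {p i : ℤ} (h : i < p) (a : JetCoord ⊕ ℕ → ℝ) : tauVar p a i = 0 := by
  rw [tauVar, if_pos h]

theorem tauVar_self {p : ℤ} (hp : p ≠ 1) (a : JetCoord ⊕ ℕ → ℝ) : tauVar p a p = 1 := by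
  simp [tauVar, firstNonlocal, hp]

theorem tauVar_add_one {p : ℤ} (hp : p ≠ 1) (a : JetCoord ⊕ ℕ → ℝ) :
    tauVar p a (p + 1) = (1 - (p : ℝ)) * a (.inl .y) := by
  simp [tauVar, firstNonlocal, hp]

theorem tauVar_firstNonlocal_add (p : ℤ) (a : JetCoord ⊕ ℕ → ℝ) (n : ℕ) :
    tauVar p a (firstNonlocal p + n) = a (.inr n) := by
  have h : p ≤ firstNonlocal p := by
    rw [firstNonlocal]; split_ifs <;> omega
  rw [tauVar, if_neg (by omega), if_neg (by omega)]
  simp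

theorem tauVar_one_eq (a : JetCoord ⊕ ℕ → ℝ) {i : ℤ} (hi : 2 ≤ i) :
    tauVar 1 a i = tauVar 2 a i := by
  rcases (by omega : i = 2 ∨ i = 3 ∨ 4 ≤ i) with rfl | rfl | h
  · norm_num [tauVar, firstNonlocal]
  · norm_num [tauVar, firstNonlocal]
  · simp [tauVar, firstNonlocal, show ¬ i < 1 by omega, show ¬ i < 2 by omega,
      show ¬ i < 4 by omega]

theorem tau_one_eq_tau_two : tau 1 = tau 2 := by
  have h (a : JetCoord ⊕ ℕ → ℝ) := cutX_one_eq (proj a) (tauVar_of_lt (p := 1) one_pos a)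
    (fun i hi => tauVar_one_eq a hi)
  have h' (a : JetCoord ⊕ ℕ → ℝ) := cutY_one_eq (proj a) (tauVar_of_lt (p := 1) one_pos a)
    (fun i hi => tauVar_one_eq a hi)
  simp only [tau, h, h']
  rfl

theorem isOpen_tau_dom (p : ℤ) : IsOpen (tau p).total.dom :=
  (tau p).isOpen_total_dom isOpen_equation_dom

theorem smoothFn_tauVar (p i : ℤ) (U : Set (JetCoord ⊕ ℕ → ℝ)) :
    SmoothFn U (fun b => tauVar p b i) := by
  unfold tauVar
  split_ifs
  · exact smoothFn_const 0
  · exact smoothFn_const 1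
  · simpa using (smoothFn_const (U := U) 0).sub (smoothFn_coord (Sum.inl JetCoord.y))
  · exact smoothFn_const 1
  · exact (smoothFn_const _).mul (smoothFn_coord _)
  · exact smoothFn_coord _

theorem smoothFn_cutY (p i : ℤ) :
    SmoothFn (tau p).total.dom (fun b => cutY p (proj b) (tauVar p b) i) := by
  induction i using int_induction_two (p := p) with
  | h0 i hi => simpa only [cutY_of_lt hi] using smoothFn_const 0
  | h i hi h1 h2 =>
    have hne : ∀ b ∈ (tau p).total.dom, b (.inl (.uy 0)) ≠ 0 := fun b hb => hb
    simp only [cutY_eq (fun i hi => tauVar_of_lt hi _) _ i]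
    exact (((smoothFn_const _).mul (smoothFn_tauVar p _ _)).sub
      ((((smoothFn_coord _).add (smoothFn_coord _)).div (smoothFn_coord _) hne).mul h1)).add
      (((smoothFn_const _).div (smoothFn_coord _) hne).mul h2)

theorem smoothFn_cutX (p i : ℤ) :
    SmoothFn (tau p).total.dom (fun b => cutX p (proj b) (tauVar p b) i) :=
  (smoothFn_cutY p (i - 1)).div (smoothFn_coord _) fun _ hb => hb

/-- For the nonlocal variables this is the definition of the covering. The content lies in the
normalized lowest variables, whose prescribed values have to solve the cut system themselves. -/
theorem app_tauVar {p : ℤ} (i : ℤ) (a : JetCoord ⊕ ℕ → ℝ) :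
    ((tau p).total.D 0).app (fun b => tauVar p b i) a = cutX p (proj a) (tauVar p a) i ∧
    ((tau p).total.D 1).app (fun b => tauVar p b i) a = cutY p (proj a) (tauVar p a) i := by
  have hq : ∀ i < p, tauVar p a i = 0 := fun i hi => tauVar_of_lt hi a
  by_cases h1 : i < p
  · simp only [tauVar_of_lt h1, VField.app_const, cutY_of_lt h1, cutX_of_le h1.le, and_self]
  by_cases h2 : firstNonlocal p ≤ i
  · obtain ⟨n, rfl⟩ := Int.le.dest h2
    simp only [tauVar_firstNonlocal_add, VField.app_coord]
    exact ⟨rfl, rfl⟩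
  have hc (Z : VField (JetCoord ⊕ ℕ)) (c : ℝ) :
      Z.app (fun b => c * b (.inl .y)) a = c * Z (.inl .y) a := by
    rw [(smoothFn_coord (U := Set.univ) _).app_const_mul c isOpen_univ (Set.mem_univ a),
      VField.app_coord]
  have hx : (tau p).total.D 0 (.inl .y) a = 0 := rfl
  have hy : (tau p).total.D 1 (.inl .y) a = 1 := rfl
  by_cases hp : p = 1
  · subst hp
    have hY1 : cutY 1 (proj a) (tauVar 1 a) 1 = 0 := by
      rw [cutY_eq hq, cutY_of_lt (by norm_num), cutY_of_lt (by norm_num), hq _ (by norm_num)]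
      simp
    have hY2 : cutY 1 (proj a) (tauVar 1 a) 2 = 0 := by
      rw [cutY_eq hq, show (2 : ℤ) - 1 = 1 by norm_num, hY1, cutY_of_lt (by norm_num)]
      simp
    have hY3 : cutY 1 (proj a) (tauVar 1 a) 3 = -1 := by
      rw [cutY_eq hq, show (3 : ℤ) - 1 = 2 by norm_num, show (3 : ℤ) - 2 = 1 by norm_num, hY1, hY2]
      norm_num [tauVar, firstNonlocal]
    have h4 : firstNonlocal 1 = 4 := rfl
    rcases (by omega : i = 1 ∨ i = 2 ∨ i = 3) with rfl | rfl | rfl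
    · refine ⟨?_, ?_⟩
      · rw [cutX_of_le le_rfl]
        simpa [tauVar, firstNonlocal] using VField.app_const _ 1 a
      · rw [hY1]
        simpa [tauVar, firstNonlocal] using VField.app_const _ 1 a
    · refine ⟨?_, ?_⟩
      · rw [cutX, show (2 : ℤ) - 1 = 1 by norm_num, hY1, zero_div]
        simpa [tauVar, firstNonlocal] using VField.app_const _ 1 a
      · rw [hY2]
        simpa [tauVar, firstNonlocal] using VField.app_const _ 1 a
    · have e : (fun b => tauVar 1 b 3) = fun b => (-1) * b (.inl .y) := by
        funext b
        norm_num [tauVar, firstNonlocal]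
      refine ⟨?_, ?_⟩
      · rw [cutX, show (3 : ℤ) - 1 = 2 by norm_num, hY2, zero_div, e, hc, hx, mul_zero]
      · rw [hY3, e, hc, hy, mul_one]
  · have hY0 : cutY p (proj a) (tauVar p a) p = 0 := by
      rw [cutY_eq hq, cutY_of_lt (by omega), cutY_of_lt (by omega), hq _ (by omega)]
      simp
    have hpn : firstNonlocal p = p + 2 := if_neg hp
    rcases (by omega : i = p ∨ i = p + 1) with rfl | rfl
    · simp only [tauVar_self hp, VField.app_const, hY0, cutX_of_le le_rfl, and_self]
    · simp only [tauVar_add_one hp, hc, hx, hy]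
      rw [cutX, cutY_eq hq _ (p + 1), add_sub_cancel_right, hY0, cutY_of_lt (by omega),
        tauVar_self hp]
      push_cast
      constructor
      · simp
      · ring

theorem tau_system (p i : ℤ) (a : JetCoord ⊕ ℕ → ℝ) :
    ((tau p).total.D 1).app (fun b => tauVar p b i) a =
        (2 - (i : ℝ)) * tauVar p a (i - 1)
          - (a (.inl (.u 1)) + a (.inl (.u 0))) / a (.inl (.uy 0)) *
            ((tau p).total.D 1).app (fun b => tauVar p b (i - 1)) a
          + 1 / a (.inl (.uy 0)) *
            ((tau p).total.D 1).app (fun b => tauVar p b (i - 2)) a ∧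
    ((tau p).total.D 0).app (fun b => tauVar p b i) a =
        ((tau p).total.D 1).app (fun b => tauVar p b (i - 1)) a / a (.inl (.uy 0)) := by
  simp only [(app_tauVar _ a).1, (app_tauVar _ a).2]
  exact ⟨cutY_eq (fun i hi => tauVar_of_lt hi a) _ i, rfl⟩

theorem app_cutY_eq_app_cutX (p i : ℤ) {a : JetCoord ⊕ ℕ → ℝ} (ha : a ∈ (tau p).total.dom) :
    ((tau p).total.D 0).app (fun b => cutY p (proj b) (tauVar p b) i) a =
      ((tau p).total.D 1).app (fun b => cutX p (proj b) (tauVar p b) i) a := by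
  set U := (tau p).total.dom
  have hU : IsOpen U := isOpen_tau_dom p
  have hne : ∀ b ∈ U, b (.inl (.uy 0)) ≠ 0 := fun b hb => hb
  let s : (JetCoord ⊕ ℕ → ℝ) → ℝ :=
    fun b => (b (.inl (.u 1)) + b (.inl (.u 0))) / b (.inl (.uy 0))
  let v : (JetCoord ⊕ ℕ → ℝ) → ℝ := fun b => 1 / b (.inl (.uy 0))
  let Y : ℤ → (JetCoord ⊕ ℕ → ℝ) → ℝ := fun i b => cutY p (proj b) (tauVar p b) i
  have hu (k : JetCoord) : SmoothFn U (fun b => b (.inl k)) := smoothFn_coord _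
  have hs : SmoothFn U s := ((hu _).add (hu _)).div (hu _) hne
  have hv : SmoothFn U v := (smoothFn_const 1).div (hu _) hne
  have hY (i : ℤ) : SmoothFn U (Y i) := smoothFn_cutY p i
  have hq (i : ℤ) : SmoothFn U (fun b => tauVar p b i) := smoothFn_tauVar p i U
  have hYrec (i : ℤ) :
      Y i = fun b => ((2 - (i : ℝ)) * tauVar p b (i - 1) - s b * Y (i - 1) b) +
        v b * Y (i - 2) b :=
    funext fun b => cutY_eq (fun i hi => tauVar_of_lt hi b) _ i
  have hXeq (i : ℤ) : (fun b => cutX p (proj b) (tauVar p b) i) =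
      fun b => v b * Y (i - 1) b := by
    funext b
    change Y (i - 1) b / b (.inl (.uy 0)) = 1 / b (.inl (.uy 0)) * Y (i - 1) b
    ring
  have hZY (Z : VField (JetCoord ⊕ ℕ)) (i : ℤ) : Z.app (Y i) a =
      ((2 - (i : ℝ)) * Z.app (fun b => tauVar p b (i - 1)) a
        - (Z.app s a * Y (i - 1) a + s a * Z.app (Y (i - 1)) a))
      + (Z.app v a * Y (i - 2) a + v a * Z.app (Y (i - 2)) a) := by
    conv_lhs => rw [hYrec i]
    rw [(((smoothFn_const _).mul (hq _)).sub (hs.mul (hY _))).app_add (hv.mul (hY _)) hU ha,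
      ((smoothFn_const _).mul (hq _)).app_sub (hs.mul (hY _)) hU ha,
      (hq _).app_const_mul _ hU ha, hs.app_mul (hY _) hU ha, hv.app_mul (hY _) hU ha]
  have hZX (Z : VField (JetCoord ⊕ ℕ)) (i : ℤ) :
      Z.app (fun b => cutX p (proj b) (tauVar p b) i) a =
        Z.app v a * Y (i - 1) a + v a * Z.app (Y (i - 1)) a := by
    rw [hXeq, hv.app_mul (hY _) hU ha]
  have hZs (Z : VField (JetCoord ⊕ ℕ)) : Z.app s a =
      ((Z (.inl (.u 1)) a + Z (.inl (.u 0)) a) * a (.inl (.uy 0))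
        - (a (.inl (.u 1)) + a (.inl (.u 0))) * Z (.inl (.uy 0)) a) / a (.inl (.uy 0)) ^ 2 := by
    rw [((hu _).add (hu _)).app_div (hu _) hne hU ha, (hu _).app_add (hu _) hU ha]
    simp only [VField.app_coord]
  have hZv (Z : VField (JetCoord ⊕ ℕ)) : Z.app v a =
      -Z (.inl (.uy 0)) a / a (.inl (.uy 0)) ^ 2 := by
    rw [(smoothFn_const 1).app_div (hu _) hne hU ha]
    simp only [VField.app_coord, VField.app_const]
    ring
  have hx0 : (tau p).total.D 0 (.inl (.u 0)) a = a (.inl (.u 1)) := rfl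
  have hx1 : (tau p).total.D 0 (.inl (.u 1)) a = a (.inl (.u 2)) := rfl
  have hxy : (tau p).total.D 0 (.inl (.uy 0)) a = a (.inl (.uy 1)) := rfl
  have hy0 : (tau p).total.D 1 (.inl (.u 0)) a = a (.inl (.uy 0)) := rfl
  have hy1 : (tau p).total.D 1 (.inl (.u 1)) a = a (.inl (.uy 1)) := rfl
  have hyy : (tau p).total.D 1 (.inl (.uy 0)) a =
      a (.inl (.uy 0)) * a (.inl (.u 2)) - (a (.inl (.u 1)) + a (.inl (.u 0))) * a (.inl (.uy 1))
        + a (.inl (.u 1)) * a (.inl (.uy 0)) := rfl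
  have ha0 : a (.inl (.uy 0)) ≠ 0 := ha
  -- the two identities that express the compatibility of the system
  have e1 : ((tau p).total.D 0).app s a + ((tau p).total.D 1).app v a = 0 := by
    rw [hZs, hZv, hx0, hx1, hxy, hyy]
    field_simp
    ring
  have e2 : ((tau p).total.D 0).app v a - s a * ((tau p).total.D 1).app v a
      + v a * ((tau p).total.D 1).app s a - v a = 0 := by
    rw [hZs, hZv, hZv, hxy, hy0, hy1]
    simp only [s, v]
    field_simp
    ring
  change ((tau p).total.D 0).app (Y i) a = _
  induction i using int_induction_two (p := p) with
  | h0 i hi =>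
    have h1 : Y i = fun _ => 0 := funext fun b => cutY_of_lt hi _ _
    have h2 : (fun b => cutX p (proj b) (tauVar p b) i) = fun _ => 0 :=
      funext fun b => cutX_of_le hi.le _ _
    rw [h1, h2, VField.app_const, VField.app_const]
  | h i hi h1 h2 =>
    have hqx : ((tau p).total.D 0).app (fun b => tauVar p b (i - 1)) a = v a * Y (i - 2) a := by
      rw [(app_tauVar _ a).1]
      have := congrFun (hXeq (i - 1)) a
      rwa [show i - 1 - 1 = i - 2 by ring] at this
    have hqy : ((tau p).total.D 1).app (fun b => tauVar p b (i - 2)) a = Y (i - 2) a :=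
      (app_tauVar _ a).2
    -- The induction hypotheses replace D_x Y_{i-1} and D_x Y_{i-2}. What remains is a multiple of
    -- `e1` by Y_{i-1} and of `e2` by Y_{i-2}; the summand -v in `e2` is the difference between the
    -- factors 2-i and 3-i of consecutive equations.
    rw [hZX] at h1 h2 ⊢
    rw [hZY, h1, h2, hqx, hZY _ (i - 1), show i - 1 - 1 = i - 2 by ring,
      show i - 1 - 2 = i - 3 by ring, show i - 2 - 1 = i - 3 by ring, hqy]
    push_cast
    linear_combination (-Y (i - 1) a) * e1 + Y (i - 2) a * e2

theorem isCovering_tau (p : ℤ) : (tau p).IsCovering := by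
  refine ⟨isIntegrable_equation, (tau p).isIntegrable_total isIntegrable_equation
    (fun i n => ?_) (fun i j n a ha => ?_)⟩
  · fin_cases i
    · exact smoothFn_cutX p _
    · exact smoothFn_cutY p _
  · fin_cases i <;> fin_cases j
    · rfl
    · exact app_cutY_eq_app_cutX p _ ha
    · exact (app_cutY_eq_app_cutX p _ ha).symm
    · rfl

/-! ### Real powers of formal power series -/

section RealPowers

open PowerSeries

/-- The coefficient of `z ^ k` in `(1 + z) ^ β`. -/
def binom (β : ℝ) (k : ℕ) : ℝ := (∏ j ∈ Finset.range k, (β - j)) / k.factorial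

@[simp] theorem binom_zero (β : ℝ) : binom β 0 = 1 := by simp [binom]

@[simp] theorem binom_one (β : ℝ) : binom β 1 = β := by simp [binom]

theorem succ_mul_binom_succ (β : ℝ) (k : ℕ) :
    binom β (k + 1) * (k + 1) = (β - k) * binom β k := by
  have h1 : ((k : ℝ) + 1) ≠ 0 := by positivity
  have h2 : (k.factorial : ℝ) ≠ 0 := by positivity
  rw [binom, binom, Finset.prod_range_succ, Nat.factorial_succ]
  push_cast
  field_simp

/-- The power `W ^ β` of a power series `W` with constant coefficient `1`. -/
def rpow (W : ℝ⟦X⟧) (β : ℝ) : ℝ⟦X⟧ := (PowerSeries.mk (binom β)).subst (W - 1)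

/-- The differential equation of (1+z)^β; every later property of `rpow` under differentiation comes
from it. -/
theorem one_add_X_mul_derivative_binom (β : ℝ) :
    (1 + X) * d⁄dX ℝ (PowerSeries.mk (binom β)) = β • PowerSeries.mk (binom β) := by
  ext n
  rw [add_mul, one_mul, map_add]
  cases n with
  | zero =>
    simp [coeff_derivative, smul_eq_mul]
  | succ n =>
    rw [coeff_succ_X_mul]
    simp only [coeff_derivative, coeff_mk, map_smul, smul_eq_mul]
    have := succ_mul_binom_succ β (n + 1)
    push_cast at this ⊢
    linear_combination this

variable {W : ℝ⟦X⟧}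

theorem hasSubst_sub_one (hW : constantCoeff W = 1) : HasSubst (W - 1) :=
  HasSubst.of_constantCoeff_zero' (by simp [hW])

theorem coeff_sub_one_pow_eq_zero (hW : constantCoeff W = 1) {n k : ℕ} (h : n < k) :
    coeff n ((W - 1) ^ k) = 0 := by
  have : (X : ℝ⟦X⟧) ^ k ∣ (W - 1) ^ k := pow_dvd_pow_of_dvd (X_dvd_iff.2 (by simp [hW])) k
  exact X_pow_dvd_iff.1 this n h

theorem coeff_subst_sub_one (hW : constantCoeff W = 1) (f : ℝ⟦X⟧) {n N : ℕ} (h : n ≤ N) :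
    coeff n (f.subst (W - 1)) =
      ∑ k ∈ Finset.range (N + 1), coeff k f * coeff n ((W - 1) ^ k) := by
  rw [coeff_subst' (hasSubst_sub_one hW),
    finsum_eq_sum_of_support_subset (s := Finset.range (N + 1))]
  · simp only [smul_eq_mul]
  · intro k hk
    by_contra hk'
    simp only [Finset.coe_range, Set.mem_Iio, not_lt] at hk'
    exact hk (by simp [coeff_sub_one_pow_eq_zero hW (show n < k by omega)])

theorem coeff_rpow (hW : constantCoeff W = 1) (β : ℝ) (n : ℕ) :
    coeff n (rpow W β) = ∑ k ∈ Finset.range (n + 1), binom β k * coeff n ((W - 1) ^ k) := by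
  rw [rpow, coeff_subst_sub_one hW _ le_rfl]
  simp only [coeff_mk]

theorem constantCoeff_rpow (hW : constantCoeff W = 1) (β : ℝ) : constantCoeff (rpow W β) = 1 := by
  rw [← coeff_zero_eq_constantCoeff_apply, coeff_rpow hW]
  simp

theorem coeff_one_rpow (hW : constantCoeff W = 1) (β : ℝ) :
    coeff 1 (rpow W β) = β * coeff 1 W := by
  rw [coeff_rpow hW, Finset.sum_range_succ, Finset.sum_range_one]
  simp [coeff_one]

theorem mul_subst_derivative_binom (hW : constantCoeff W = 1) (β : ℝ) :
    W * (d⁄dX ℝ (PowerSeries.mk (binom β))).subst (W - 1) = β • rpow W β := by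
  have h := congrArg (fun f : ℝ⟦X⟧ => f.subst (W - 1)) (one_add_X_mul_derivative_binom β)
  have hs := hasSubst_sub_one hW
  simp only [subst_mul hs, subst_smul hs, subst_add hs, subst_X hs] at h
  have h1 : (1 : ℝ⟦X⟧).subst (W - 1) = 1 := by
    rw [← coe_substAlgHom hs, map_one]
  rw [h1, add_sub_cancel] at h
  exact h

/-- The logarithmic derivative of W^β is β times that of W, cleared of denominators. -/
theorem mul_derivative_rpow (hW : constantCoeff W = 1) (β : ℝ) :
    W * d⁄dX ℝ (rpow W β) = β • (rpow W β * d⁄dX ℝ W) := by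
  rw [rpow, derivative_subst (hasSubst_sub_one hW), ← mul_assoc, mul_subst_derivative_binom hW,
    ← rpow, smul_mul_assoc, map_sub, derivative_one, sub_zero]

/-- Both sides have the same logarithmic derivative, so their quotient has derivative zero, and its
constant term is 1. This avoids proving a composition law for binomial series. -/
theorem rpow_rpow_inv (hW : constantCoeff W = 1) (β : ℝ) (hβ : β ≠ 0) :
    rpow (rpow W β) β⁻¹ = W := by
  set V := rpow W β with hV
  have hV1 : constantCoeff V = 1 := constantCoeff_rpow hW β
  have hU1 : constantCoeff (rpow V β⁻¹) = 1 := constantCoeff_rpow hV1 _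
  have h1 := mul_derivative_rpow hW β
  have h2 := mul_derivative_rpow hV1 β⁻¹
  rw [← hV] at h1
  set T := rpow V β⁻¹
  have hV0 : V ≠ 0 := fun h => by simp [h] at hV1
  have hWi : W * W⁻¹ = 1 := PowerSeries.mul_inv_cancel W (by simp [hW])
  have h3 : W * d⁄dX ℝ T = T * d⁄dX ℝ W := by
    refine mul_left_cancel₀ hV0 ?_
    rw [mul_left_comm, h2, mul_smul_comm, mul_left_comm, h1, mul_smul_comm, smul_smul,
      inv_mul_cancel₀ hβ, one_smul]
    ring
  have h4 : T * W⁻¹ = 1 := by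
    refine derivative.ext ?_ (by simp [hU1, hW])
    rw [Derivation.leibniz, derivative_inv', derivative_one, smul_eq_mul, smul_eq_mul]
    linear_combination (W⁻¹ ^ 2) * h3 - (W⁻¹ * d⁄dX ℝ T) * hWi
  calc T = T * (W * W⁻¹) := by rw [hWi, mul_one]
    _ = T * W⁻¹ * W := by ring
    _ = W := by rw [h4, one_mul]

end RealPowers

/-! ### Coefficientwise derivatives of curves of power series -/

section Curves

open PowerSeries

/-- The curve `W` of power series has the coefficientwise derivative `W'` at `t`. -/
def HasCoeffDerivAt (W : ℝ → ℝ⟦X⟧) (W' : ℝ⟦X⟧) (t : ℝ) : Prop :=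
  ∀ n, HasDerivAt (fun t => coeff n (W t)) (coeff n W') t

variable {W V : ℝ → ℝ⟦X⟧} {W' V' : ℝ⟦X⟧} {t : ℝ}

theorem HasCoeffDerivAt.mul (hW : HasCoeffDerivAt W W' t) (hV : HasCoeffDerivAt V V' t) :
    HasCoeffDerivAt (fun t => W t * V t) (W' * V t + W t * V') t := by
  intro n
  simp only [coeff_mul, map_add, ← Finset.sum_add_distrib]
  exact HasDerivAt.fun_sum fun p _ => (hW p.1).mul (hV p.2)

theorem HasCoeffDerivAt.pow (hW : HasCoeffDerivAt W W' t) (k : ℕ) :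
    HasCoeffDerivAt (fun t => W t ^ k) (k * W t ^ (k - 1) * W') t := by
  induction k with
  | zero =>
    intro n
    simpa using hasDerivAt_const t (coeff n (1 : ℝ⟦X⟧))
  | succ k ih =>
    have h := ih.mul hW
    simp only [pow_succ]
    convert h using 1
    cases k with
    | zero => simp
    | succ k =>
      rw [Nat.add_sub_cancel, Nat.add_sub_cancel]
      push_cast
      ring

/-- Each coefficient of W^β is a finite polynomial in the coefficients of W, so it can be
differentiated termwise. The derivative is characterized by a product relation, which is all that is
needed since W can be cancelled. -/
theorem HasCoeffDerivAt.rpow (hW1 : ∀ t, constantCoeff (W t) = 1)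
    (hW : HasCoeffDerivAt W W' t) (β : ℝ) :
    ∃ V' : ℝ⟦X⟧, HasCoeffDerivAt (fun t => rpow (W t) β) V' t ∧
      W t * V' = β • (rpow (W t) β * W') := by
  have hz : HasCoeffDerivAt (fun t => W t - 1) W' t := fun n => by
    simpa using (hW n).sub_const (coeff n (1 : ℝ⟦X⟧))
  refine ⟨(d⁄dX ℝ (PowerSeries.mk (binom β))).subst (W t - 1) * W', fun n => ?_, ?_⟩
  -- Both sums run one index further than needed for W^β, so that the index shift k ↦ k-1 caused by
  -- differentiating the binomial series matches term by term.
  · have h1 : coeff n ((d⁄dX ℝ (PowerSeries.mk (binom β))).subst (W t - 1) * W') =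
        ∑ k ∈ Finset.range (n + 1 + 1), binom β k *
          coeff n ((k : ℝ⟦X⟧) * (W t - 1) ^ (k - 1) * W') := by
      rw [Finset.sum_range_succ']
      simp only [Nat.cast_zero, zero_mul, map_zero, mul_zero, add_zero, Nat.add_sub_cancel]
      rw [coeff_mul, Finset.sum_congr rfl fun p hp => by
        rw [coeff_subst_sub_one (hW1 t) (N := n) _
          (by have := Finset.HasAntidiagonal.mem_antidiagonal.1 hp; omega), Finset.sum_mul]]
      rw [Finset.sum_comm]
      refine Finset.sum_congr rfl fun k _ => ?_
      rw [mul_assoc, ← nsmul_eq_mul, map_nsmul, coeff_mul, nsmul_eq_mul, Finset.mul_sum,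
        Finset.mul_sum]
      refine Finset.sum_congr rfl fun p _ => ?_
      rw [coeff_derivative, coeff_mk]
      push_cast
      ring
    have h2 : (fun t => coeff n (UHE.rpow (W t) β)) = fun t =>
        ∑ k ∈ Finset.range (n + 1 + 1), binom β k * coeff n ((W t - 1) ^ k) := by
      funext t
      rw [UHE.rpow, coeff_subst_sub_one (hW1 t) _ (Nat.le_succ n)]
      simp only [coeff_mk]
    rw [h1, h2]
    exact HasDerivAt.fun_sum fun k _ => ((hz.pow k) n).const_mul _
  · rw [← mul_assoc, mul_subst_derivative_binom (hW1 t), smul_mul_assoc]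

end Curves

/-! ### Smoothness of the coefficients of powers -/

section Smooth

open PowerSeries

variable {ι : Type*} {U : Set (ι → ℝ)}

theorem smoothFn_coeff_pow {W : (ι → ℝ) → ℝ⟦X⟧} (hW : ∀ n, SmoothFn U (fun a => coeff n (W a)))
    (k n : ℕ) : SmoothFn U (fun a => coeff n (W a ^ k)) := by
  induction k generalizing n with
  | zero => simpa only [pow_zero] using smoothFn_const _
  | succ k ih =>
    simp only [pow_succ, coeff_mul]
    exact SmoothFn.sum _ fun p _ => (ih _).mul (hW _)

theorem smoothFn_coeff_rpow {W : (ι → ℝ) → ℝ⟦X⟧}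
    (hW1 : ∀ a, constantCoeff (W a) = 1) (hW : ∀ n, SmoothFn U (fun a => coeff n (W a)))
    (β : ℝ) (n : ℕ) : SmoothFn U (fun a => coeff n (rpow (W a) β)) := by
  simp only [coeff_rpow (hW1 _)]
  refine SmoothFn.sum _ fun k _ => (smoothFn_const _).mul (smoothFn_coeff_pow (fun m => ?_) _ _)
  simpa only [map_sub] using (hW m).sub (smoothFn_const _)

end Smooth

/-! ### Generating functions and the equivalences -/

section Equivalences

open PowerSeries

/-- The generating function `∑ q_{p+n} λⁿ` of the variables of `τ^p`. -/
def tauSeries (p : ℤ) (a : JetCoord ⊕ ℕ → ℝ) : ℝ⟦X⟧ :=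
  PowerSeries.mk fun n => tauVar p a (p + n)

/-- The generating function of the right-hand sides of the system cut at level `p`. -/
def cutSeries (p : ℤ) (a : JetCoord ⊕ ℕ → ℝ) : ℝ⟦X⟧ :=
  PowerSeries.mk fun n => cutY p (proj a) (tauVar p a) (p + n)

/-- The series `1 + (u_x + u) / u_y λ - 1 / u_y λ²`. -/
def symbolSeries (a : JetCoord → ℝ) : ℝ⟦X⟧ :=
  1 + C ((a (.u 1) + a (.u 0)) / a (.uy 0)) * X - C (1 / a (.uy 0)) * X ^ 2

theorem symbolSeries_ne_zero (a : JetCoord → ℝ) : symbolSeries a ≠ 0 := fun h => by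
  simpa [symbolSeries] using congrArg constantCoeff h

/-- The recursion in generating form: with m = n-1, the factor 2-(p+n) is (1-p)-m, which is the
operator (1-p) - λ d/dλ on the coefficient of λ^m. -/
theorem symbolSeries_mul_cutSeries (p : ℤ) (a : JetCoord ⊕ ℕ → ℝ) :
    symbolSeries (proj a) * cutSeries p a =
      X * (C (1 - (p : ℝ)) * tauSeries p a - X * d⁄dX ℝ (tauSeries p a)) := by
  have hq : ∀ i < p, tauVar p a i = 0 := fun i hi => tauVar_of_lt hi a
  have h0 : cutY p (proj a) (tauVar p a) p = 0 := by
    rw [cutY_eq hq, cutY_of_lt (by omega), cutY_of_lt (by omega), hq _ (by omega)]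
    simp
  have hA : symbolSeries (proj a) * cutSeries p a = cutSeries p a
      + C ((proj a (.u 1) + proj a (.u 0)) / proj a (.uy 0)) * (X * cutSeries p a)
      - C (1 / proj a (.uy 0)) * (X * (X * cutSeries p a)) := by
    rw [symbolSeries]
    ring
  -- An opaque name keeps `map_sub` from splitting `C (1 - p)` in the simplifications below.
  obtain ⟨c, hc⟩ : ∃ c : ℝ, c = 1 - p := ⟨_, rfl⟩
  rw [hA, ← hc]
  ext n
  rcases n with _ | _ | n
  · simp [cutSeries, h0]
  · simp only [map_add, map_sub, coeff_C_mul, coeff_succ_X_mul, zero_add, coeff_zero_X_mul,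
      cutSeries, tauSeries, coeff_mk, Nat.cast_zero, Nat.cast_one, add_zero]
    rw [cutY_eq hq _ (p + 1), add_sub_cancel_right, h0, cutY_of_lt (by omega), hc]
    push_cast
    ring
  · simp only [map_add, map_sub, coeff_C_mul, coeff_succ_X_mul, coeff_derivative,
      cutSeries, tauSeries, coeff_mk]
    rw [cutY_eq hq _ (p + ((n + 1 + 1 : ℕ) : ℤ)),
      show p + ((n + 1 + 1 : ℕ) : ℤ) - 1 = p + ((n + 1 : ℕ) : ℤ) by push_cast; ring,
      show p + ((n + 1 + 1 : ℕ) : ℤ) - 2 = p + (n : ℤ) by push_cast; ring, hc]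
    push_cast
    ring

theorem constantCoeff_tauSeries {p : ℤ} (hp : p ≠ 1) (a : JetCoord ⊕ ℕ → ℝ) :
    constantCoeff (tauSeries p a) = 1 := by
  simp [tauSeries, tauVar_self hp]

theorem coeff_one_tauSeries {p : ℤ} (hp : p ≠ 1) (a : JetCoord ⊕ ℕ → ℝ) :
    coeff 1 (tauSeries p a) = (1 - (p : ℝ)) * a (.inl .y) := by
  simp [tauSeries, tauVar_add_one hp]

theorem coeff_add_two_tauSeries {p : ℤ} (hp : p ≠ 1) (a : JetCoord ⊕ ℕ → ℝ) (n : ℕ) :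
    coeff (n + 2) (tauSeries p a) = a (.inr n) := by
  rw [← tauVar_firstNonlocal_add p a n, firstNonlocal, if_neg hp, tauSeries, coeff_mk]
  congr 1
  push_cast
  ring

theorem smoothFn_coeff_tauSeries (p : ℤ) (U : Set (JetCoord ⊕ ℕ → ℝ)) (n : ℕ) :
    SmoothFn U (fun a => coeff n (tauSeries p a)) := by
  simpa only [tauSeries, coeff_mk] using smoothFn_tauVar p _ U

/-- The map over the equation that raises the generating function of `τ^p` to the power
`(1 - r) / (1 - p)`. -/
def powMap (p r : ℤ) (a : JetCoord ⊕ ℕ → ℝ) : JetCoord ⊕ ℕ → ℝ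
  | .inl k => a (.inl k)
  | .inr n => coeff (n + 2) (rpow (tauSeries p a) ((1 - (r : ℝ)) / (1 - (p : ℝ))))

theorem one_sub_cast_ne_zero {p : ℤ} (hp : p ≠ 1) : 1 - (p : ℝ) ≠ 0 :=
  sub_ne_zero.2 fun h => hp (by exact_mod_cast h.symm)

theorem smoothFn_powMap {p : ℤ} (hp : p ≠ 1) (r : ℤ) (U : Set (JetCoord ⊕ ℕ → ℝ))
    (k : JetCoord ⊕ ℕ) :
    SmoothFn U (fun a => powMap p r a k) := by
  cases k with
  | inl k => exact smoothFn_coord _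
  | inr n =>
    exact smoothFn_coeff_rpow (constantCoeff_tauSeries hp) (smoothFn_coeff_tauSeries p U) _ _

theorem hasCoeffDerivAt_tauSeries (p : ℤ) (Z : VField (JetCoord ⊕ ℕ)) (a : JetCoord ⊕ ℕ → ℝ) :
    HasCoeffDerivAt (fun t => tauSeries p (Z.line a t))
      (PowerSeries.mk fun n => Z.app (fun b => tauVar p b (p + n)) a) 0 := by
  intro n
  simpa only [tauSeries, coeff_mk] using
    (smoothFn_tauVar p (p + n) Set.univ).hasDerivAt_line isOpen_univ Z (Set.mem_univ a)

variable {p r : ℤ}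

/-- The coefficients from λ² on agree by construction of `powMap`. The first two are not free: the
constant term of the power is 1, and its linear term is β(1-p)y = (1-r)y, exactly the normalization
of `τ^r`. -/
theorem tauSeries_powMap (hp : p ≠ 1) (hr : r ≠ 1) (a : JetCoord ⊕ ℕ → ℝ) :
    tauSeries r (powMap p r a) =
      rpow (tauSeries p a) ((1 - (r : ℝ)) / (1 - (p : ℝ))) := by
  have hW := constantCoeff_tauSeries hp a
  ext n
  rcases n with _ | _ | n
  · rw [coeff_zero_eq_constantCoeff_apply, coeff_zero_eq_constantCoeff_apply,
      constantCoeff_tauSeries hr, constantCoeff_rpow hW]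
  · rw [zero_add, coeff_one_tauSeries hr, coeff_one_rpow hW, coeff_one_tauSeries hp, ← mul_assoc,
      div_mul_cancel₀ _ (one_sub_cast_ne_zero hp)]
    rfl
  · rw [coeff_add_two_tauSeries hr]
    rfl

theorem powMap_powMap (hp : p ≠ 1) (hr : r ≠ 1) (a : JetCoord ⊕ ℕ → ℝ) :
    powMap r p (powMap p r a) = a := by
  funext k
  cases k with
  | inl k => rfl
  | inr n =>
    rw [powMap, tauSeries_powMap hp hr, ← inv_div (1 - (r : ℝ)),
      rpow_rpow_inv (constantCoeff_tauSeries hp a)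
      _ (div_ne_zero (one_sub_cast_ne_zero hr) (one_sub_cast_ne_zero hp)),
      coeff_add_two_tauSeries hp]

/-- The derivatives of the components of `powMap` satisfy the system cut at level `r`. -/
theorem app_powMap_inr (hp : p ≠ 1) (hr : r ≠ 1) (n : ℕ) (a : JetCoord ⊕ ℕ → ℝ) :
    ((tau p).total.D 0).app (fun b => powMap p r b (.inr n)) a =
      cutX r (proj a) (tauVar r (powMap p r a)) (firstNonlocal r + n) ∧
    ((tau p).total.D 1).app (fun b => powMap p r b (.inr n)) a =
      cutY r (proj a) (tauVar r (powMap p r a)) (firstNonlocal r + n) := by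
  set β := (1 - (r : ℝ)) / (1 - (p : ℝ)) with hβ
  have hβp : β * (1 - (p : ℝ)) = 1 - r := div_mul_cancel₀ _ (one_sub_cast_ne_zero hp)
  set W := tauSeries p a with hW
  set V := rpow W β with hV
  have hW1 : constantCoeff W = 1 := constantCoeff_tauSeries hp a
  have hW0 : W ≠ 0 := fun h => by simp [h] at hW1
  have hVr : tauSeries r (powMap p r a) = V := tauSeries_powMap hp hr a
  have hd : W * d⁄dX ℝ V = C β * (V * d⁄dX ℝ W) := by
    rw [← smul_eq_C_mul]
    exact mul_derivative_rpow hW1 β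
  have hA0 := symbolSeries_ne_zero (proj a)
  have hAp : symbolSeries (proj a) * cutSeries p a = X * (C (1 - (p : ℝ)) * W - X * d⁄dX ℝ W) :=
    symbolSeries_mul_cutSeries p a
  have hAr : symbolSeries (proj a) * cutSeries r (powMap p r a) =
      X * (C (1 - (r : ℝ)) * V - X * d⁄dX ℝ V) := by
    rw [← hVr]
    exact symbolSeries_mul_cutSeries r (powMap p r a)
  have hC : (C (1 - (r : ℝ)) : ℝ⟦X⟧) = C β * C (1 - (p : ℝ)) := by rw [← map_mul, hβp]
  -- This says that the y-equations at levels p and r correspond under V = W^β: both are multiplied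
  -- by A, which is then cancelled.
  have hY : W * cutSeries r (powMap p r a) = C β * (V * cutSeries p a) := by
    refine mul_left_cancel₀ hA0 ?_
    linear_combination W * hAr - C β * V * hAp - X ^ 2 * hd + X * V * W * hC
  have happ (Z : VField (JetCoord ⊕ ℕ)) :
      ∃ V' : ℝ⟦X⟧, Z.app (fun b => powMap p r b (.inr n)) a = coeff (n + 2) V' ∧
        W * V' = C β * (V * PowerSeries.mk fun n => Z.app (fun b => tauVar p b (p + n)) a) := by
    obtain ⟨V', h1, h2⟩ := (hasCoeffDerivAt_tauSeries p Z a).rpow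
      (fun t => constantCoeff_tauSeries hp _) β
    refine ⟨V', ?_, ?_⟩
    · exact ((smoothFn_powMap hp r Set.univ (.inr n)).hasDerivAt_line isOpen_univ Z
        (Set.mem_univ a)).unique (h1 (n + 2))
    · simpa only [VField.line_zero, smul_eq_C_mul] using h2
  have hfr : firstNonlocal r = r + 2 := if_neg hr
  constructor
  · obtain ⟨V', h1, h2⟩ := happ ((tau p).total.D 0)
    have hX : (PowerSeries.mk fun n => ((tau p).total.D 0).app (fun b => tauVar p b (p + n)) a) =
        C (1 / proj a (.uy 0)) * (X * cutSeries p a) := by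
      ext m
      rw [coeff_mk, (app_tauVar _ a).1, coeff_C_mul]
      cases m with
      | zero => simp [cutX_of_le]
      | succ m =>
        rw [coeff_succ_X_mul, cutSeries, coeff_mk, cutX,
          show p + ((m + 1 : ℕ) : ℤ) - 1 = p + m by push_cast; ring]
        ring
    have h3 : V' = C (1 / proj a (.uy 0)) * (X * cutSeries r (powMap p r a)) := by
      refine mul_left_cancel₀ hW0 ?_
      rw [h2, hX]
      linear_combination -(C (1 / proj a (.uy 0)) * X) * hY
    rw [h1, h3, coeff_C_mul, coeff_succ_X_mul, cutSeries, coeff_mk, cutX, hfr,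
      show r + ((n + 1 : ℕ) : ℤ) = r + 2 + n - 1 by push_cast; ring, one_div_mul_eq_div]
    rfl
  · obtain ⟨V', h1, h2⟩ := happ ((tau p).total.D 1)
    simp only [(app_tauVar _ a).2] at h2
    have h3 : V' = cutSeries r (powMap p r a) := mul_left_cancel₀ hW0 (h2.trans hY.symm)
    rw [h1, h3, cutSeries, coeff_mk, hfr,
      show r + ((n + 2 : ℕ) : ℤ) = r + 2 + n by push_cast; ring]
    rfl

/-- The total derivatives are carried exactly onto each other, so the identity matrix serves as μ.
-/
theorem isEquivalence_powMap (hp : p ≠ 1) (hr : r ≠ 1) :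
    (tau p).IsEquivalence (tau r) (powMap p r) := by
  refine ⟨powMap r p, fun a ha => ⟨ha, powMap_powMap hp hr a⟩,
    fun b hb => ⟨hb, powMap_powMap hr hp b⟩, smoothFn_powMap hp r _, smoothFn_powMap hr p _,
    fun _ _ => rfl, fun i j _ => if i = j then 1 else 0, fun i j => smoothFn_const _,
    fun i b _ k => ?_⟩
  simp only [ite_mul, one_mul, zero_mul, Finset.sum_ite_eq, Finset.mem_univ, if_true]
  cases k with
  | inl k => exact VField.app_coord _ _ _
  | inr n =>
    have h := app_powMap_inr hp hr n (powMap r p b)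
    rw [powMap_powMap hr hp] at h
    fin_cases i
    · exact h.1
    · exact h.2

end Equivalences

theorem tau_equivalent (p r : ℤ) : (tau p).Equivalent (tau r) := by
  have key (p : ℤ) : ∃ p' : ℤ, p' ≠ 1 ∧ tau p = tau p' := by
    rcases eq_or_ne p 1 with rfl | h
    · exact ⟨2, by norm_num, tau_one_eq_tau_two⟩
    · exact ⟨p, h, rfl⟩
  obtain ⟨p', hp, hp'⟩ := key p
  obtain ⟨r', hr, hr'⟩ := key r
  rw [hp', hr']
  exact ⟨_, isEquivalence_powMap hp hr⟩

/-! ### The explicit change of variables -/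

section ChangeVars

open PowerSeries

/-- On the generic series q = ∑ q_k λ^k the operator 𝒴 agrees with d/dλ. Both are derivations, so
they agree on powers of q. -/
theorem opY_coeff_pow (m j : ℕ) :
    opY (coeff j ((PowerSeries.mk (MvPolynomial.X : ℕ → MvPolynomial ℕ ℝ)) ^ m)) =
      coeff (j + 1) ((PowerSeries.mk (MvPolynomial.X : ℕ → MvPolynomial ℕ ℝ)) ^ m) * (j + 1) := by
  set q : PowerSeries (MvPolynomial ℕ ℝ) := PowerSeries.mk MvPolynomial.X with hq
  have h1 (j : ℕ) : opY (coeff j q) = coeff j (d⁄dX _ q) := by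
    rw [hq, coeff_derivative, coeff_mk, coeff_mk, opY, MvPolynomial.mkDerivation_X]
    simp [mul_comm]
  rw [← coeff_derivative]
  induction m generalizing j with
  | zero =>
    rw [pow_zero, derivative_one, map_zero, coeff_one]
    split_ifs <;> simp
  | succ m ih =>
    rw [pow_succ, Derivation.leibniz, coeff_mul, map_sum, smul_eq_mul, smul_eq_mul,
      mul_comm q, map_add, coeff_mul, coeff_mul, ← Finset.sum_add_distrib]
    refine Finset.sum_congr rfl fun x _ => ?_
    rw [Derivation.leibniz, h1, ih, smul_eq_mul, smul_eq_mul]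
    ring

/-- Passing from the coefficient of λ^j to that of λ^(j+1) is differentiation followed by division
by j+1, which is the recursion defining `P`. -/
theorem P_eq_coeff (i j : ℕ) :
    P i j = MvPolynomial.C (1 / ((i + 2).factorial : ℝ)) *
      coeff j ((PowerSeries.mk (MvPolynomial.X : ℕ → MvPolynomial ℕ ℝ)) ^ (i + 2)) := by
  induction j with
  | zero => simp [P]
  | succ j ih =>
    have hj : MvPolynomial.C (1 / ((j : ℝ) + 1)) * ((j : MvPolynomial ℕ ℝ) + 1) = 1 := by
      have h : ((j : MvPolynomial ℕ ℝ) + 1) = MvPolynomial.C ((j : ℝ) + 1) := by simp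
      rw [h, ← map_mul, one_div_mul_cancel (by positivity), map_one]
    rw [P, ih, ← MvPolynomial.smul_eq_C_mul (_ : MvPolynomial ℕ ℝ) (1 / ((i + 2).factorial : ℝ)),
      Derivation.map_smul, opY_coeff_pow, MvPolynomial.smul_eq_C_mul]
    linear_combination (MvPolynomial.C (1 / ((i + 2).factorial : ℝ)) *
      coeff (j + 1) ((PowerSeries.mk (MvPolynomial.X : ℕ → MvPolynomial ℕ ℝ)) ^ (i + 2))) * hj

theorem PSup_eq_coeff (p : ℤ) (i j : ℕ) (a : JetCoord ⊕ ℕ → ℝ) :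
    PSup p i j a = 1 / ((i + 2).factorial : ℝ) *
      coeff j ((PowerSeries.mk fun k : ℕ => qSup p a k) ^ (i + 2)) := by
  have h : (PowerSeries.mk fun k : ℕ => qSup p a k) = PowerSeries.map
      (MvPolynomial.eval fun k : ℕ => qSup p a k) (PowerSeries.mk MvPolynomial.X) := by
    ext k
    simp
  rw [PSup, P_eq_coeff, map_mul, MvPolynomial.eval_C, h, ← map_pow, coeff_map]

theorem binom_one_sub (p : ℝ) (l : ℕ) :
    binom (1 - p) (l + 2) =
      -(1 - p) * p * ((-1) ^ l * ∏ k ∈ Finset.Icc 1 l, (p + k)) / (l + 2).factorial := by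
  rw [binom]
  congr 1
  induction l with
  | zero =>
    simp [Finset.prod_range_succ]
    ring
  | succ l ih =>
    rw [Finset.prod_range_succ, ih, Finset.prod_Icc_succ_top (by omega)]
    push_cast
    ring

/-- The expansion of (1 + λq)^(1-p): the linear term gives (1-p) q_i, and the terms of degree l+2 in
q, by `binom_one_sub`, give -(1-p)p times the summands of d_i. -/
theorem changeVars_eq_powMap (p : ℤ) : changeVars p = powMap 0 p := by
  funext a k
  cases k with
  | inl k => rfl
  | inr n =>
    set q : ℝ⟦X⟧ := PowerSeries.mk fun k : ℕ => qSup 0 a k with hq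
    have hz : tauSeries 0 a - 1 = X * q := by
      ext m
      cases m with
      | zero => simp [tauSeries, tauVar_self (zero_ne_one' ℤ)]
      | succ m =>
        rw [coeff_succ_X_mul, map_sub, coeff_one, if_neg (by omega), tauSeries, coeff_mk, hq,
          coeff_mk, qSup, sub_zero]
        congr 1
    have hW := constantCoeff_tauSeries (zero_ne_one' ℤ) a
    rw [powMap, Int.cast_zero, sub_zero, div_one, coeff_rpow hW, Finset.sum_range_succ',
      Finset.sum_range_succ', hz]
    have h0 : coeff (n + 2) ((X * q) ^ 0) = 0 := by
      rw [pow_zero, coeff_one, if_neg (by omega)]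
    have h1 : coeff (n + 2) ((X * q) ^ (0 + 1)) = qSup 0 a (n + 1) := by
      rw [zero_add, pow_one, coeff_succ_X_mul, hq, coeff_mk]
      push_cast
      rfl
    rw [h0, h1, changeVars, dCoeff, zero_add, binom_one, mul_zero, add_zero]
    -- The factor λ^(l+2) lowers the extracted coefficient from n+2 to n-l, the second subscript of
    -- P for i = n+1.
    have hl : ∀ l ∈ Finset.range (n + 1),
        binom (1 - (p : ℝ)) (l + 1 + 1) * coeff (n + 2) ((X * q) ^ (l + 1 + 1)) =
          -(1 - (p : ℝ)) * p * ((-1) ^ l * (∏ k ∈ Finset.Icc 1 l, ((p : ℝ) + k)) *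
            PSup 0 l (n + 1 - l - 1) a) := by
      intro l hl
      have hl' : l < n + 1 := Finset.mem_range.1 hl
      rw [mul_pow, coeff_X_pow_mul', if_pos (by omega), binom_one_sub, PSup_eq_coeff,
        show n + 2 - (l + 1 + 1) = n + 1 - l - 1 by omega]
      ring
    rw [Finset.sum_congr rfl hl, ← Finset.mul_sum]
    ring

end ChangeVars

end UHE

end

theorem mainTheorem3 :
    -- every `τ^p` is a covering, and the defining system holds on it for all `i ∈ ℤ`
    (∀ p : ℤ, (UHE.tau p).IsCovering ∧
      ∀ i : ℤ, ∀ a ∈ (UHE.tau p).total.dom,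
        ((UHE.tau p).total.D 1).app (fun b => UHE.tauVar p b i) a =
            (2 - (i : ℝ)) * UHE.tauVar p a (i - 1)
              - (a (.inl (.u 1)) + a (.inl (.u 0))) / a (.inl (.uy 0)) *
                ((UHE.tau p).total.D 1).app (fun b => UHE.tauVar p b (i - 1)) a
              + 1 / a (.inl (.uy 0)) *
                ((UHE.tau p).total.D 1).app (fun b => UHE.tauVar p b (i - 2)) a ∧
        ((UHE.tau p).total.D 0).app (fun b => UHE.tauVar p b i) a =
            ((UHE.tau p).total.D 1).app (fun b => UHE.tauVar p b (i - 1)) a /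
              a (.inl (.uy 0))) ∧
    -- the coverings are pairwise equivalent
    (∀ p r : ℤ, (UHE.tau p).Equivalent (UHE.tau r)) ∧
    -- for `p ≠ 1` the explicit change of variables is an equivalence of `τ^0` and `τ^p`
    (∀ p : ℤ, p ≠ 1 → (UHE.tau 0).IsEquivalence (UHE.tau p) (UHE.changeVars p)) ∧
    -- in the system cut at level `1` the variable `q_1` is a constant that enters no equation,
    -- and without it this is the system cut at level `2`
    (∀ (a : UHE.JetCoord → ℝ) (q : ℤ → ℝ), (∀ i < 1, q i = 0) → ∀ i : ℤ,
      UHE.cutY 1 a q i = UHE.cutY 2 a (Function.update q 1 0) i ∧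
      UHE.cutX 1 a q i = UHE.cutX 2 a (Function.update q 1 0) i) ∧
    -- `τ^1` coincides with `τ^2`
    UHE.tau 1 = UHE.tau 2 := by
  refine ⟨fun p => ⟨UHE.isCovering_tau p, fun i a _ => UHE.tau_system p i a⟩,
    UHE.tau_equivalent, fun p hp => ?_, fun a q hq i => ?_, UHE.tau_one_eq_tau_two⟩
  · rw [UHE.changeVars_eq_powMap]
    exact UHE.isEquivalence_powMap (by norm_num) hp
  · have h : ∀ i : ℤ, 2 ≤ i → q i = Function.update q 1 0 i := fun i hi => by
      rw [Function.update_of_ne (by omega)]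
    exact ⟨UHE.cutY_one_eq a (hq 0 one_pos) h i, UHE.cutX_one_eq a (hq 0 one_pos) h i⟩
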